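/- Let $\mathcal L$ be a modular lattice of finite rank $n$, i.e. with minimum $\mathbf 0$ and maximum $\mathbf 1$, where $n$ is the maximum length $k$ of a chain $p_0\prec p_1\prec\cdots\prec p_k$ in $\mathcal L$. Let $K(\mathcal L)$ be the set of formal convex combinations $x=\sum_{p\in\mathcal L}\lambda(p)\,p$ (finitely many nonzero coefficients, $\lambda(p)\ge 0$, $\sum_p\lambda(p)=1$) whose support $\{p : \lambda(p)\neq 0\}$ is a chain. For a maximal chain $p_0\prec p_1\prec\cdots\prec p_n$, let $\sigma$ be the simplex of all $x\in K(\mathcal L)$ whose support is contained in $\{p_0,\dots,p_n\}$, and put $\varphi_\sigma\big(\sum_{i=0}^n\lambda_i p_i\big)=\sum_{i=1}^n\lambda_i 1_{[i]}\in\mathbb R^n$, where $1_{[i]}$ is the indicator vector of $\{1,\dots,i\}$, and $d_\sigma(x,y)=\|\varphi_\sigma(x)-\varphi_\sigma(y)\|_2$ for $x,y\in\sigma$. The length of a path $\gamma:[0,1]\to K(\mathcal L)$ is the supremum of $\sum_{i=0}^{N-1}d_{\sigma_i}(\gamma(t_i),\gamma(t_{i+1}))$ over all $0=t_0<t_1<\cdots<t_N=1$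 such that each $\gamma([t_i,t_{i+1}])$ is contained in a simplex $\sigma_i$ (only paths that admit such a subdivision are considered), and $d(x,y)$ is the infimum of the lengths of the paths connecting $x$ and $y$; with this metric $K(\mathcal L)$ is the orthoscheme complex of $\mathcal L$. For a function $f:\mathcal L\to\mathbb R$, let $\overline f:K(\mathcal L)\to\mathbb R$, $\overline f\big(\sum_p\lambda(p)p\big)=\sum_p\lambda(p)f(p)$, be its Lovász extension. Then the following hold. (2) If $f$ is bounded, then $\overline f$ is $L$-Lipschitz with $L=2\sqrt n\,\sup_{p\in\mathcal L}|f(p)|$ (the supremum being the maximum when it is attained), that is, $|\overline f(x)-\overline f(y)|\le 2\sqrt n\,\big(\sup_{p\in\mathcal L}|f(p)|\big)\,d(x,y)$ for all $x,y\in K(\mathcal L)$. (3) If $f$ is integer-valued and bounded below (so that $\min_{p\in\mathcal L} f(p)$ exists), then for every $x\in K(\mathcal L)$ with $\overline f(x)-\min_{p\in\mathcal L}f(p)<1$, the support of $x$ contains a minimizer of $f$. -/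

import Mathlib

/-- The geometric realization `K(L)` of the order complex of `L`: formal convex combinations
`∑ λ(p) p` of finitely many elements of `L` whose support is a chain. -/
structure OrderComplex (L : Type*) [PartialOrder L] where
  /-- The coefficient function `p ↦ λ(p)`. -/
  weight : L →₀ ℝ
  nonneg : ∀ p, 0 ≤ weight p
  sum_eq_one : weight.sum (fun _ a => a) = 1
  isChain : IsChain (· ≤ ·) (weight.support : Set L)

namespace OrderComplex

variable {L : Type*} [PartialOrder L]

/-- The simplex of the chain `p₀ < p₁ < ⋯ < pₘ`: the points whose support is contained in it. -/
def simplex (c : LTSeries L) : Set (OrderComplex L) :=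
  {x | (x.weight.support : Set L) ⊆ Set.range c}

/-- `p₀ < p₁ < ⋯ < pₘ` is a maximal chain of `L` (in a modular lattice of rank `n`, all maximal
chains have length `m = n`). -/
def IsMaximalSeries (c : LTSeries L) : Prop :=
  IsMaxChain (· ≤ ·) (Set.range c)

/-- The vector `1_{[i]}` of `ℝᵐ`, where `[i] = {1, …, i}`; the index `i : Fin m` stands for the
number `i + 1`. -/
noncomputable def initialIndicator {m : ℕ} (i : Fin m) : EuclideanSpace ℝ (Fin m) :=
  WithLp.toLp 2 (fun k => if k ≤ i then 1 else 0)

/-- The coordinate map `φ_σ(∑_{i=0}^m λᵢ pᵢ) = ∑_{i=1}^m λᵢ 1_{[i]}` of the simplex `σ` of the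
chain `p₀ < ⋯ < pₘ`, onto the orthoscheme with vertices `0, 1_{[1]}, …, 1_{[m]}` in `ℝᵐ`. -/
noncomputable def orthoschemeCoord (c : LTSeries L) (x : OrderComplex L) :
    EuclideanSpace ℝ (Fin c.length) :=
  ∑ i : Fin c.length, x.weight (c i.succ) • initialIndicator i

/-- The metric `d_σ(x, y) = ‖φ_σ(x) - φ_σ(y)‖₂` of a maximal simplex `σ`
(used for `x, y ∈ σ` only). -/
noncomputable def simplexDist (c : LTSeries L) (x y : OrderComplex L) : ℝ :=
  ‖orthoschemeCoord c x - orthoschemeCoord c y‖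

/-- `γ` is a path from `x` to `y`. Continuity is that of every coefficient. For a map which admits
a subdivision as in `pathSums` (only such paths have a length) this is the same as continuity for
the simplicial topology of `K(L)`, since each of the finitely many pieces then runs in a single
closed simplex of finite dimension. -/
def IsPath (γ : unitInterval → OrderComplex L) (x y : OrderComplex L) : Prop :=
  (∀ p : L, Continuous fun s => (γ s).weight p) ∧ γ 0 = x ∧ γ 1 = y

/-- The sums `∑ d_{σᵢ}(γ(tᵢ), γ(tᵢ₊₁))` over all subdivisions `0 = t₀ < t₁ < ⋯ < t_N = 1` and
simplices `σᵢ` with `γ([tᵢ, tᵢ₊₁]) ⊆ σᵢ`. -/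
def pathSums (γ : unitInterval → OrderComplex L) : Set ℝ :=
  {S | ∃ (N : ℕ) (t : Fin (N + 1) → unitInterval) (σ : Fin N → LTSeries L),
    StrictMono t ∧ t 0 = 0 ∧ t (Fin.last N) = 1 ∧
    (∀ i, IsMaximalSeries (σ i)) ∧
    (∀ i : Fin N, ∀ s ∈ Set.Icc (t i.castSucc) (t i.succ), γ s ∈ simplex (σ i)) ∧
    S = ∑ i : Fin N, simplexDist (σ i) (γ (t i.castSucc)) (γ (t i.succ))}

/-- `ℓ` is the length of `γ`. A path that admits no subdivision as in `pathSums`, or that has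
infinite length, has no length in this sense: neither `∅` nor an unbounded set has a least upper
bound in `ℝ`. -/
def HasLength (γ : unitInterval → OrderComplex L) (ℓ : ℝ) : Prop :=
  IsLUB (pathSums γ) ℓ

/-- The metric of the orthoscheme complex: the infimum of the lengths of the paths
from `x` to `y`. -/
noncomputable def orthoschemeDist (x y : OrderComplex L) : ℝ :=
  sInf {ℓ | ∃ γ : unitInterval → OrderComplex L, IsPath γ x y ∧ HasLength γ ℓ}

/-- The Lovász extension `f̄(∑ λ(p) p) = ∑ λ(p) f(p)`. -/
noncomputable def lovaszExtension (f : L → ℝ) (x : OrderComplex L) : ℝ :=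
  x.weight.sum fun p a => a * f p

end OrderComplex

/-! On a simplex with vertices `p₀ < ⋯ < pₘ`, the extension is affine in the orthoscheme coordinates
with slopes `f pₖ₊₁ - f pₖ`, each at most `2M` in absolute value when `|f| ≤ M`. Cauchy–Schwarz
gives the local constant `2√m M`, and `m ≤ n`. Adding over one subdivision of a path bounds the
change of the extension by `2√n M` times the length; then the infimum over paths is taken. Since a
real `sInf` of the empty set is `0`, some path with a length must be exhibited: the one from `x` to
`y` through `⊤`. The minimizer claim is an averaging argument combined with the integrality gap. -/

namespace OrderComplex

/-! ### Estimates in one simplex and along a path -/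

section Simplex

variable {L : Type*} [PartialOrder L]

theorem finsupp_sum_eq_sum_range (c : LTSeries L) {x : OrderComplex L} (hx : x ∈ simplex c)
    (g : L → ℝ) :
    (x.weight.sum fun p a => a * g p) =
      ∑ i : Fin (c.length + 1), x.weight (c i) * g (c i) := by
  classical
  have hsub : x.weight.support ⊆ Finset.univ.image c := by
    intro p hp
    obtain ⟨i, hi⟩ := hx (Finset.mem_coe.2 hp)
    exact Finset.mem_image.2 ⟨i, Finset.mem_univ _, hi⟩
  rw [Finsupp.sum_of_support_subset _ hsub _ (by simp),
    Finset.sum_image fun i _ j _ h => c.strictMono.injective h]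

theorem orthoschemeCoord_apply (c : LTSeries L) (x : OrderComplex L) (k : Fin c.length) :
    orthoschemeCoord c x k = ∑ i : Fin c.length, if k ≤ i then x.weight (c i.succ) else 0 := by
  simp [orthoschemeCoord, initialIndicator]

/-- Telescoping; it turns the slopes into differences from the bottom vertex. -/
theorem sum_le_sub_eq {m : ℕ} (g : Fin (m + 1) → ℝ) (i : Fin m) :
    (∑ k : Fin m, if k ≤ i then g k.succ - g k.castSucc else 0) = g i.succ - g 0 := by
  induction m with
  | zero => exact i.elim0
  | succ m ih =>
    rw [Fin.sum_univ_succ]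
    refine Fin.cases ?_ (fun j => ?_) i
    · simp [Fin.succ_ne_zero]
    · have := ih (fun k => g k.succ) j
      simp only [Fin.succ_le_succ_iff, Fin.castSucc_succ] at this ⊢
      simp only [Fin.succ_castSucc] at this ⊢
      rw [this]
      simp

/-- On a simplex the Lovász extension is affine in the orthoscheme coordinates. -/
theorem lovaszExtension_eq_of_mem_simplex (c : LTSeries L) {x : OrderComplex L}
    (hx : x ∈ simplex c) (f : L → ℝ) :
    lovaszExtension f x = f (c 0) +
      ∑ k : Fin c.length, orthoschemeCoord c x k * (f (c k.succ) - f (c k.castSucc)) := by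
  have hsum : ∑ i : Fin (c.length + 1), x.weight (c i) = 1 := by
    have := finsupp_sum_eq_sum_range c hx fun _ => 1
    simp only [mul_one] at this
    rw [← this, x.sum_eq_one]
  have hcoord : ∑ k : Fin c.length,
      orthoschemeCoord c x k * (f (c k.succ) - f (c k.castSucc)) =
      ∑ i : Fin c.length, x.weight (c i.succ) * (f (c i.succ) - f (c 0)) := by
    -- Summation by parts: each coordinate is a tail sum of weights, so exchanging the sums makes
    -- the slopes telescope.
    simp_rw [orthoschemeCoord_apply, Finset.sum_mul]
    rw [Finset.sum_comm]
    refine Finset.sum_congr rfl fun i _ => ?_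
    rw [← sum_le_sub_eq (fun j => f (c j)) i, Finset.mul_sum]
    refine Finset.sum_congr rfl fun k _ => ?_
    split_ifs <;> simp
  rw [lovaszExtension, finsupp_sum_eq_sum_range c hx f, hcoord, Fin.sum_univ_succ]
  rw [Fin.sum_univ_succ] at hsum
  simp_rw [mul_sub]
  rw [Finset.sum_sub_distrib, ← Finset.sum_mul]
  linear_combination f (c 0) * hsum

/-- The Lovász extension is Lipschitz on each simplex. -/
theorem abs_lovaszExtension_sub_le_simplexDist (c : LTSeries L) {x y : OrderComplex L}
    (hx : x ∈ simplex c) (hy : y ∈ simplex c) {f : L → ℝ} {M : ℝ} (hM : ∀ p, |f p| ≤ M) :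
    |lovaszExtension f x - lovaszExtension f y| ≤
      2 * Real.sqrt c.length * M * simplexDist c x y := by
  have hM0 : 0 ≤ M := (abs_nonneg _).trans (hM (c 0))
  set v := orthoschemeCoord c x - orthoschemeCoord c y with hv
  have hdiff : lovaszExtension f x - lovaszExtension f y =
      ∑ k : Fin c.length, v k * (f (c k.succ) - f (c k.castSucc)) := by
    rw [lovaszExtension_eq_of_mem_simplex c hx, lovaszExtension_eq_of_mem_simplex c hy,
      add_sub_add_left_eq_sub, ← Finset.sum_sub_distrib]
    exact Finset.sum_congr rfl fun k _ => by simp [hv, sub_mul]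
  -- Cauchy–Schwarz against the all-ones vector, the source of the square root.
  have hl1 : ∑ k, |v k| ≤ Real.sqrt c.length * ‖v‖ := by
    rw [EuclideanSpace.norm_eq, ← Real.sqrt_mul (Nat.cast_nonneg _)]
    refine Real.le_sqrt_of_sq_le ?_
    simpa using sq_sum_le_card_mul_sum_sq (s := Finset.univ) (f := fun k => |v k|)
  calc |lovaszExtension f x - lovaszExtension f y|
      ≤ ∑ k : Fin c.length, |v k| * (2 * M) := by
        rw [hdiff]
        refine (Finset.abs_sum_le_sum_abs _ _).trans (Finset.sum_le_sum fun k _ => ?_)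
        rw [abs_mul]
        refine mul_le_mul_of_nonneg_left ?_ (abs_nonneg _)
        linarith [abs_sub (f (c k.succ)) (f (c k.castSucc)), hM (c k.succ), hM (c k.castSucc)]
    _ = (∑ k, |v k|) * (2 * M) := by rw [Finset.sum_mul]
    _ ≤ Real.sqrt c.length * ‖v‖ * (2 * M) := by gcongr
    _ = 2 * Real.sqrt c.length * M * simplexDist c x y := by rw [simplexDist, ← hv]; ring

theorem norm_initialIndicator_le {m : ℕ} (i : Fin m) : ‖initialIndicator i‖ ≤ Real.sqrt m := by
  rw [EuclideanSpace.norm_eq]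
  refine Real.sqrt_le_sqrt ?_
  calc ∑ k, ‖initialIndicator i k‖ ^ 2 ≤ ∑ _k : Fin m, (1 : ℝ) := by
        refine Finset.sum_le_sum fun k _ => ?_
        simp only [initialIndicator]
        split_ifs <;> simp
    _ = m := by simp

/-- A crude triangle-inequality bound; it serves only to show that certain paths have finite length.
-/
theorem simplexDist_le (c : LTSeries L) (x y : OrderComplex L) {δ : ℝ}
    (h : ∀ p, |x.weight p - y.weight p| ≤ δ) :
    simplexDist c x y ≤ c.length * Real.sqrt c.length * δ := by
  have hδ : 0 ≤ δ := (abs_nonneg _).trans (h (c 0))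
  rw [simplexDist, orthoschemeCoord, orthoschemeCoord, ← Finset.sum_sub_distrib]
  calc _ ≤ ∑ _i : Fin c.length, δ * Real.sqrt c.length := by
        refine norm_sum_le_of_le _ fun i _ => ?_
        rw [← sub_smul, norm_smul, Real.norm_eq_abs]
        exact mul_le_mul (h _) (norm_initialIndicator_le i) (norm_nonneg _) hδ
    _ = c.length * Real.sqrt c.length * δ := by
        rw [Finset.sum_const, Finset.card_univ, Fintype.card_fin, nsmul_eq_mul]; ring

theorem weight_le_one (x : OrderComplex L) (p : L) : x.weight p ≤ 1 := by
  by_cases hp : p ∈ x.weight.support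
  · rw [← x.sum_eq_one]
    exact Finset.single_le_sum (f := fun q => x.weight q) (fun q _ => x.nonneg q) hp
  · rw [Finsupp.notMem_support_iff.1 hp]
    exact zero_le_one

/-- The Lovász extension changes by at most a constant multiple of the length along
any path that has a length. -/
theorem abs_lovaszExtension_sub_le_length {n : ℕ} (hn : ∀ c : LTSeries L, c.length ≤ n)
    {f : L → ℝ} {M : ℝ} (hM : ∀ p, |f p| ≤ M) {γ : unitInterval → OrderComplex L}
    {x y : OrderComplex L} (hγ : IsPath γ x y) {ℓ : ℝ} (hℓ : HasLength γ ℓ) :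
    |lovaszExtension f x - lovaszExtension f y| ≤ 2 * Real.sqrt n * M * ℓ := by
  obtain ⟨S, hS⟩ := hℓ.nonempty
  have hSℓ : S ≤ ℓ := hℓ.1 hS
  obtain ⟨N, t, σ, ht, ht0, ht1, -, hσ, rfl⟩ := hS
  have hMn : 0 ≤ M := by
    obtain ⟨p, -⟩ : x.weight.support.Nonempty := by
      rw [Finset.nonempty_iff_ne_empty]
      intro h
      have := x.sum_eq_one
      simp [Finsupp.sum, h] at this
    exact (abs_nonneg _).trans (hM p)
  have htel : lovaszExtension f y - lovaszExtension f x =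
      ∑ i : Fin N, (lovaszExtension f (γ (t i.succ)) - lovaszExtension f (γ (t i.castSucc))) := by
    have h1 := Fin.sum_univ_succ fun i => lovaszExtension f (γ (t i))
    have h2 := Fin.sum_univ_castSucc fun i => lovaszExtension f (γ (t i))
    rw [ht0, hγ.2.1] at h1
    rw [ht1, hγ.2.2] at h2
    rw [Finset.sum_sub_distrib]
    linarith
  rw [abs_sub_comm, htel]
  calc _ ≤ ∑ i : Fin N, 2 * Real.sqrt n * M *
          simplexDist (σ i) (γ (t i.castSucc)) (γ (t i.succ)) := by
        refine (Finset.abs_sum_le_sum_abs _ _).trans (Finset.sum_le_sum fun i _ => ?_)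
        have hle : t i.castSucc ≤ t i.succ := ht.monotone (Fin.castSucc_lt_succ).le
        rw [abs_sub_comm]
        refine (abs_lovaszExtension_sub_le_simplexDist (σ i) (hσ i _ ⟨le_rfl, hle⟩)
          (hσ i _ ⟨hle, le_rfl⟩) hM).trans ?_
        have : Real.sqrt (σ i).length ≤ Real.sqrt n :=
          Real.sqrt_le_sqrt (Nat.cast_le.2 (hn (σ i)))
        have : 0 ≤ simplexDist (σ i) (γ (t i.castSucc)) (γ (t i.succ)) := norm_nonneg _
        gcongr
    _ ≤ 2 * Real.sqrt n * M * ℓ := by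
        rw [← Finset.mul_sum]
        gcongr

/-- A path whose coefficients are uniformly Lipschitz has bounded subdivision sums. -/
theorem bddAbove_pathSums {n : ℕ} (hn : ∀ c : LTSeries L, c.length ≤ n)
    {γ : unitInterval → OrderComplex L} {K : ℝ} (hK : 0 ≤ K)
    (h : ∀ s t p, |(γ s).weight p - (γ t).weight p| ≤ K * |(s : ℝ) - t|) :
    BddAbove (pathSums γ) := by
  refine ⟨n * Real.sqrt n * K, ?_⟩
  rintro _ ⟨N, t, σ, ht, ht0, ht1, -, -, rfl⟩
  have htel : ∑ i : Fin N, ((t i.succ : ℝ) - t i.castSucc) = 1 := by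
    have h1 := Fin.sum_univ_succ fun i => (t i : ℝ)
    have h2 := Fin.sum_univ_castSucc fun i => (t i : ℝ)
    rw [ht0] at h1
    rw [ht1] at h2
    rw [Finset.sum_sub_distrib]
    simp only [Set.Icc.coe_zero, Set.Icc.coe_one] at h1 h2
    linarith
  calc _ ≤ ∑ i : Fin N, n * Real.sqrt n * K * ((t i.succ : ℝ) - t i.castSucc) := by
        refine Finset.sum_le_sum fun i _ => (simplexDist_le _ _ _ (h _ _)).trans ?_
        have hle : (t i.castSucc : ℝ) ≤ t i.succ := ht.monotone (Fin.castSucc_lt_succ).le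
        rw [abs_sub_comm, abs_of_nonneg (sub_nonneg.2 hle), mul_assoc _ K]
        have hc : ((σ i).length : ℝ) ≤ n := Nat.cast_le.2 (hn (σ i))
        have := sub_nonneg.2 hle
        gcongr
    _ = n * Real.sqrt n * K := by rw [← Finset.mul_sum, htel, mul_one]

/-- In a partial order of bounded chain length, every chain lies in a maximal finite series. -/
theorem exists_isMaximalSeries [Nonempty L] {n : ℕ} (hn : ∀ c : LTSeries L, c.length ≤ n)
    {s : Set L} (hs : IsChain (· ≤ ·) s) :
    ∃ c : LTSeries L, IsMaximalSeries c ∧ s ⊆ Set.range c := by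
  classical
  obtain ⟨F, hF⟩ := hs.exists_subset_flag
  let _ : LinearOrder F := inferInstance
  have hser : ∀ (T : Finset F) (k : ℕ), T.card = k + 1 →
      ∃ c : LTSeries L, c.length = k ∧ Set.range c = (↑) '' (T : Set F) := by
    intro T k hk
    refine ⟨LTSeries.mk k (fun i => (T.orderEmbOfFin hk i : L))
      fun i j hij => (T.orderEmbOfFin hk).strictMono hij, rfl, ?_⟩
    rw [← T.range_orderEmbOfFin hk, ← Set.range_comp]
    rfl
  have : Finite F := by
    by_contra hinf
    rw [not_finite_iff_infinite] at hinf
    -- `n + 2` elements form a chain of length `n + 1`, one too long.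
    obtain ⟨T, hT⟩ := Infinite.exists_subset_card_eq F (n + 2)
    obtain ⟨c, hc, -⟩ := hser T (n + 1) hT
    have := hn c
    omega
  have := Fintype.ofFinite F
  have hne : Nonempty F := (F.maxChain.nonempty_iff.1 ‹_›).to_subtype
  obtain ⟨c, -, hc⟩ := hser Finset.univ (Fintype.card F - 1)
    (by rw [Finset.card_univ]; have := Fintype.card_pos (α := F); omega)
  have hcF : Set.range c = (F : Set L) := by
    rw [hc, Finset.coe_univ, Set.image_univ]
    exact Subtype.range_coe
  exact ⟨c, by rw [IsMaximalSeries, hcF]; exact F.maxChain, by rwa [hcF]⟩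

end Simplex

/-! ### Paths through the top element and the global Lipschitz bound -/

section Bounded

variable {L : Type*} [PartialOrder L] [OrderTop L]

/-- The point `a x + b y + (1 - a - b) ⊤` exists when one of `a`, `b` vanishes. -/
theorem exists_mix (x y : OrderComplex L) {a b : ℝ} (ha : 0 ≤ a) (hb : 0 ≤ b) (hab : a + b ≤ 1)
    (h : a = 0 ∨ b = 0) :
    ∃ z : OrderComplex L,
      z.weight = a • x.weight + b • y.weight + Finsupp.single ⊤ (1 - a - b) := by
  classical
  refine ⟨⟨_, fun p => ?_, ?_, ?_⟩, rfl⟩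
  · have h1 := x.nonneg p
    have h2 := y.nonneg p
    have h3 : 0 ≤ (Finsupp.single (⊤ : L) (1 - a - b)) p := by
      rw [Finsupp.single_apply]; split_ifs <;> linarith
    simp only [Finsupp.add_apply, Finsupp.smul_apply, smul_eq_mul]
    positivity
  · rw [Finsupp.sum_add_index' (by simp) (by simp), Finsupp.sum_add_index' (by simp) (by simp),
      Finsupp.sum_smul_index (by simp), Finsupp.sum_smul_index (by simp),
      Finsupp.sum_single_index rfl, ← Finsupp.mul_sum, ← Finsupp.mul_sum, x.sum_eq_one,
      y.sum_eq_one]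
    ring
  · have key : ∀ (w : OrderComplex L) (a r : ℝ),
        IsChain (· ≤ ·) ((a • w.weight + Finsupp.single ⊤ r).support : Set L) := by
      intro w a r
      refine (w.isChain.insert (a := ⊤) fun _ _ _ => Or.inr le_top).mono ?_
      intro p hp
      by_contra hc
      simp only [Set.mem_insert_iff, Finset.mem_coe, Finsupp.mem_support_iff, not_or,
        not_not] at hc
      exact Finsupp.mem_support_iff.1 hp (by
        simp [hc.2, Ne.symm hc.1])
    rcases h with rfl | rfl
    · rw [zero_smul, zero_add]
      exact key y b _
    · rw [zero_smul, add_zero]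
      exact key x a _

theorem exists_isPath_hasLength {n : ℕ} (hn : ∀ c : LTSeries L, c.length ≤ n)
    (x y : OrderComplex L) :
    ∃ ℓ, ∃ γ : unitInterval → OrderComplex L, IsPath γ x y ∧ HasLength γ ℓ := by
  classical
  -- The weight on `x` runs down to `0` on `[0, 1/2]`, the weight on `y` up from `0` on `[1/2, 1]`;
  -- the remaining mass sits on `⊤`, which is comparable to everything.
  let a : ℝ → ℝ := fun s => max 0 (1 - 2 * s)
  let b : ℝ → ℝ := fun s => max 0 (2 * s - 1)
  have hmix : ∀ s : unitInterval, ∃ z : OrderComplex L,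
      z.weight = a s • x.weight + b s • y.weight + Finsupp.single ⊤ (1 - a s - b s) := by
    intro s
    have h0 := s.2.1
    have h1 := s.2.2
    refine exists_mix x y (le_max_left _ _) (le_max_left _ _) ?_ ?_
    · simp only [a, b]
      rcases max_cases 0 (1 - 2 * (s : ℝ)) with h | h <;>
        rcases max_cases 0 (2 * (s : ℝ) - 1) with h' | h' <;> linarith
    · simp only [a, b]
      rcases le_total (s : ℝ) (1 / 2) with h | h
      · right; exact max_eq_left (by linarith)
      · left; exact max_eq_left (by linarith)
  choose γ hγ using hmix
  have hval : ∀ s p, (γ s).weight p =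
      a s * x.weight p + b s * y.weight p + (1 - a s - b s) * (if ⊤ = p then 1 else 0) := by
    intro s p
    rw [hγ]
    simp only [Finsupp.add_apply, Finsupp.smul_apply, smul_eq_mul, Finsupp.single_apply, mul_ite,
      mul_one, mul_zero]
  have hext : ∀ z w : OrderComplex L, z.weight = w.weight → z = w := by
    rintro ⟨⟩ ⟨⟩ h
    simpa using h
  have hpath : IsPath γ x y := by
    refine ⟨fun p => ?_, hext _ _ ?_, hext _ _ ?_⟩
    · simp only [hval, a, b]
      fun_prop
    · rw [hγ]; simp [a, b]
    · rw [hγ]; norm_num [a, b]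
  -- `8 = 2 · 2 + 2 · 2`: `a` and `b` are 2-Lipschitz, and each multiplies a difference of size at
  -- most `2`.
  have hLip : ∀ s t p, |(γ s).weight p - (γ t).weight p| ≤ 8 * |(s : ℝ) - t| := by
    intro s t p
    have ha : |a s - a t| ≤ 2 * |(s : ℝ) - t| := by
      refine (abs_max_sub_max_le_max _ _ _ _).trans (max_le (by simp) ?_)
      rw [show 1 - 2 * (s : ℝ) - (1 - 2 * t) = -(2 * (s - t)) by ring, abs_neg, abs_mul, abs_two]
    have hb : |b s - b t| ≤ 2 * |(s : ℝ) - t| := by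
      refine (abs_max_sub_max_le_max _ _ _ _).trans (max_le (by simp) ?_)
      rw [show 2 * (s : ℝ) - 1 - (2 * t - 1) = 2 * (s - t) by ring, abs_mul, abs_two]
    have hδ : |(if ⊤ = p then 1 else 0 : ℝ)| ≤ 1 := by split_ifs <;> simp
    have hx : |x.weight p| ≤ 1 := by rw [abs_of_nonneg (x.nonneg p)]; exact x.weight_le_one p
    have hy : |y.weight p| ≤ 1 := by rw [abs_of_nonneg (y.nonneg p)]; exact y.weight_le_one p
    rw [hval, hval]
    set δ : ℝ := if ⊤ = p then 1 else 0
    have hsplit : a s * x.weight p + b s * y.weight p + (1 - a s - b s) * δ -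
        (a t * x.weight p + b t * y.weight p + (1 - a t - b t) * δ) =
        (a s - a t) * (x.weight p - δ) + (b s - b t) * (y.weight p - δ) := by ring
    have h1 : |x.weight p - δ| ≤ 2 := by linarith [abs_sub (x.weight p) δ]
    have h2 : |y.weight p - δ| ≤ 2 := by linarith [abs_sub (y.weight p) δ]
    rw [hsplit]
    refine (abs_add_le _ _).trans ?_
    rw [abs_mul, abs_mul]
    have h3 := mul_le_mul ha h1 (abs_nonneg _) (by positivity)
    have h4 := mul_le_mul hb h2 (abs_nonneg _) (by positivity)
    linarith
  have hsupp : ∀ w : OrderComplex L, ∃ c : LTSeries L, IsMaximalSeries c ∧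
      insert ⊤ (w.weight.support : Set L) ⊆ Set.range c := fun w =>
    exists_isMaximalSeries hn (w.isChain.insert fun _ _ _ => Or.inr le_top)
  obtain ⟨cx, hcx, hxs⟩ := hsupp x
  obtain ⟨cy, hcy, hys⟩ := hsupp y
  have hne : (pathSums γ).Nonempty := by
    let h : unitInterval := ⟨1 / 2, by norm_num, by norm_num⟩
    have h0 : (0 : unitInterval) < h := by
      rw [← Subtype.coe_lt_coe]; norm_num [h]
    have h1 : h < 1 := by
      rw [← Subtype.coe_lt_coe]; norm_num [h]
    refine ⟨_, 2, ![0, h, 1], ![cx, cy], ?_, rfl, rfl, ?_, ?_, rfl⟩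
    · rw [Fin.strictMono_iff_lt_succ]
      intro i
      fin_cases i
      · exact h0
      · exact h1
    · intro i
      fin_cases i
      · exact hcx
      · exact hcy
    · intro i s hs
      fin_cases i
      · have hs' : (s : ℝ) ≤ 1 / 2 := hs.2
        have hbs : b s = 0 := max_eq_left (by linarith)
        refine fun p hp => hxs ?_
        by_contra hc
        simp only [Set.mem_insert_iff, Finset.mem_coe, Finsupp.mem_support_iff, not_or,
          not_not] at hc hp
        exact hp (by rw [hval, hbs, hc.2, if_neg (Ne.symm hc.1)]; ring)
      · have hs' : 1 / 2 ≤ (s : ℝ) := hs.1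
        have has : a s = 0 := max_eq_left (by linarith)
        refine fun p hp => hys ?_
        by_contra hc
        simp only [Set.mem_insert_iff, Finset.mem_coe, Finsupp.mem_support_iff, not_or,
          not_not] at hc hp
        exact hp (by rw [hval, has, hc.2, if_neg (Ne.symm hc.1)]; ring)
  obtain ⟨ℓ, hℓ⟩ := Real.exists_isLUB hne (bddAbove_pathSums hn (by norm_num) hLip)
  exact ⟨ℓ, γ, hpath, hℓ⟩

theorem abs_lovaszExtension_sub_le {n : ℕ} (hn : ∀ c : LTSeries L, c.length ≤ n)
    {f : L → ℝ} {M : ℝ} (hM : ∀ p, |f p| ≤ M) (x y : OrderComplex L) :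
    |lovaszExtension f x - lovaszExtension f y| ≤
      2 * Real.sqrt n * M * orthoschemeDist x y := by
  have hM0 : 0 ≤ M := (abs_nonneg _).trans (hM ⊤)
  have hC : 0 ≤ 2 * Real.sqrt n * M := by positivity
  have hne := exists_isPath_hasLength hn x y
  have hle : ∀ ℓ, (∃ γ : unitInterval → OrderComplex L, IsPath γ x y ∧ HasLength γ ℓ) →
      |lovaszExtension f x - lovaszExtension f y| ≤ 2 * Real.sqrt n * M * ℓ :=
    fun ℓ ⟨γ, hγ, hℓ⟩ => abs_lovaszExtension_sub_le_length hn hM hγ hℓ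
  -- A zero constant cannot be divided out, but then any single path already gives the bound.
  rcases hC.eq_or_lt with hC0 | hC0
  · obtain ⟨ℓ, hℓ⟩ := hne
    simpa [← hC0] using hle ℓ hℓ
  · rw [← div_le_iff₀' hC0]
    exact le_csInf hne fun ℓ hℓ => (div_le_iff₀' hC0).2 (hle ℓ hℓ)

end Bounded

/-! ### Minimizers of integer-valued functions -/

theorem exists_minimizer_mem_support {L : Type*} [PartialOrder L] {f : L → ℝ}
    (hf : ∀ p, ∃ z : ℤ, f p = z) (hb : BddBelow (Set.range f)) (x : OrderComplex L)
    (hx : lovaszExtension f x - (⨅ p, f p) < 1) :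
    ∃ p ∈ x.weight.support, ∀ q, f p ≤ f q := by
  -- The extension is a weighted average of `f` over the support, so some value there is below `inf
  -- f + 1`.
  obtain ⟨p, hp, hlt⟩ : ∃ p ∈ x.weight.support, f p < (⨅ p, f p) + 1 := by
    by_contra! hc
    have h1 : x.weight.sum (fun _ a => a) * ((⨅ p, f p) + 1) ≤ lovaszExtension f x := by
      rw [lovaszExtension, Finsupp.sum, Finsupp.sum, Finset.sum_mul]
      exact Finset.sum_le_sum fun p hp => mul_le_mul_of_nonneg_left (hc p hp) (x.nonneg p)
    rw [x.sum_eq_one] at h1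
    linarith
  refine ⟨p, hp, fun q => ?_⟩
  by_contra! hq
  obtain ⟨a, ha⟩ := hf p
  obtain ⟨b, hb'⟩ := hf q
  -- Integrality: a smaller value `f q` would satisfy `f q ≤ f p - 1 < inf f`.
  have hab : b + 1 ≤ a := by
    rw [ha, hb'] at hq
    exact_mod_cast hq
  have hab' : (b : ℝ) + 1 ≤ a := by exact_mod_cast hab
  linarith [ciInf_le hb q]

end OrderComplex

theorem length_le_of_height_top {L : Type*} [PartialOrder L] [OrderTop L] {n : ℕ}
    (hn : Order.height (⊤ : L) = n) (c : LTSeries L) : c.length ≤ n := by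
  have h := Order.length_le_height (p := c) (x := ⊤) le_top
  rw [hn] at h
  exact_mod_cast h

theorem proposition2p6 {L : Type*} [Lattice L] [BoundedOrder L] [IsModularLattice L]
    (n : ℕ) (hn : Order.height (⊤ : L) = n) (f : L → ℝ) :
    (BddAbove (Set.range fun p => |f p|) →
      ∀ x y : OrderComplex L,
        |OrderComplex.lovaszExtension f x - OrderComplex.lovaszExtension f y| ≤
          2 * Real.sqrt n * (⨆ p, |f p|) * OrderComplex.orthoschemeDist x y) ∧
    ((∀ p, ∃ z : ℤ, f p = z) → BddBelow (Set.range f) →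
      ∀ x : OrderComplex L,
        OrderComplex.lovaszExtension f x - (⨅ p, f p) < 1 →
          ∃ p ∈ x.weight.support, ∀ q, f p ≤ f q) := by
  have hlen := length_le_of_height_top hn
  refine ⟨fun hf x y => ?_, fun hf hb x hx => ?_⟩
  · exact OrderComplex.abs_lovaszExtension_sub_le hlen (fun p => le_ciSup hf p) x y
  · exact OrderComplex.exists_minimizer_mem_support hf hb x hx
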